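/- Let $\alpha\in[0,1]$, $\beta>0$ and $\nu>\alpha-1$ be real numbers, and for $n=0,1,2,\dots$ let $$[n]_{\alpha,\beta,\nu}!=\left(\prod_{i=1}^{n}\frac{\Gamma(\beta i+1)}{\Gamma(\beta i+1-\alpha)}\right)\frac{\Gamma(\beta n+1-\alpha+\nu)}{\Gamma(1-\alpha+\nu)}.$$ Suppose that $\frac{\alpha+\beta}{2}\le 1$. Then: 1. Carleman's condition holds: $\displaystyle\sum_{n=1}^{\infty}\bigl([n]_{\alpha,\beta,\nu}!\bigr)^{-\frac{1}{2n}}=\infty$. 2. The Stieltjes moment problem with moments $[n]_{\alpha,\beta,\nu}!$ has a solution and is determinate: there is exactly one positive Borel measure $\mu$ on $[0,\infty)$ such that, for every $n\ge 0$, $x^n$ is $\mu$-integrable and $\int x^n\,d\mu(x)=[n]_{\alpha,\beta,\nu}!$. 3. The same holds for weight functions: there is a function $\tilde U$ on $(0,\infty)$ with $\tilde U(x)>0$ for all $x>0$ such that $$\int_0^\infty x^n\,\tilde U(x)\,dx=[n]_{\alpha,\beta,\nu}!\qquad(n=0,1,2,\dots),$$ all these integrals being absolutely convergent, and every function on $(0,\infty)$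 that is nonnegative almost everywhere and has the same (absolutely convergent) moments is equal to $\tilde U$ almost everywhere. -/

import Mathlib

open MeasureTheory Filter

noncomputable section

/-- The generalised factorial
`[n]_{α,β,ν}! = (∏_{i=1}^n Γ(βi+1)/Γ(βi+1-α)) * Γ(βn+1-α+ν)/Γ(1-α+ν)`. -/
def genFactorial (α β ν : ℝ) (n : ℕ) : ℝ :=
  (∏ i ∈ Finset.Icc 1 n, Real.Gamma (β * (i : ℝ) + 1) / Real.Gamma (β * (i : ℝ) + 1 - α)) *
    (Real.Gamma (β * (n : ℝ) + 1 - α + ν) / Real.Gamma (1 - α + ν))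

/-- `μ` is a positive measure on `[0,∞)` all of whose moments are finite, the `n`-th one
being `m n`: a solution of the Stieltjes moment problem for `m`. -/
structure IsStieltjesSolution (m : ℕ → ℝ) (μ : Measure ℝ) : Prop where
  support : μ (Set.Iio 0) = 0
  integrable : ∀ n : ℕ, Integrable (fun x : ℝ => x ^ n) μ
  moment : ∀ n : ℕ, ∫ x, x ^ n ∂μ = m n

/-- `U` is a weight function on `(0,∞)`, nonnegative almost everywhere, all of whose moments
converge absolutely, with `∫₀^∞ xⁿ U(x) dx = m n`. (The case `n = 0` of `integrable` contains
the measurability of `U` on `(0,∞)`; values of `U` outside `(0,∞)` are irrelevant.) -/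
structure IsStieltjesWeight (m : ℕ → ℝ) (U : ℝ → ℝ) : Prop where
  nonneg : ∀ᵐ x ∂(volume.restrict (Set.Ioi (0 : ℝ))), 0 ≤ U x
  integrable : ∀ n : ℕ, IntegrableOn (fun x : ℝ => x ^ n * U x) (Set.Ioi 0)
  moment : ∀ n : ℕ, ∫ x in Set.Ioi (0 : ℝ), x ^ n * U x = m n

end

open scoped ENNReal NNReal BoundedContinuousFunction Topology

/-! Write r(x) = Γ(βx+1)/Γ(βx+1-α), c = 1-α+ν and m n for the moments. Carleman's condition and
determinacy both rest on the bound m n ≤ A Cⁿ (2n)! (`exists_genFactorial_le`), the only place where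
α + β ≤ 2 matters. Carleman's sum then dominates a multiple of the harmonic series. Uniqueness does
not pass through Carleman: the image of a solution under ±√x has moment generating function 2 ∑ t²ⁿ
m n/(2n)!, which is finite near 0 and hence determines the image; squaring recovers the solution.

Existence holds for every β > 0. The factor Γ(βn+c)/Γ(c) is the n-th moment of G^β with G of law
Gamma(c, 1). The product r(1)⋯r(n) is the n-th moment of some e^Y: for 0 < α < 1, Y is a weak limit
of log r(N) + β ∑_{k≤N} log B_k with independent B_k of law Beta(βk+1-α, α), and the moments
converge because r(x)/r(x+d) → 1. For G independent of Y, e^Y G^β has the required moments, and its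
density is a mixture of positive densities. -/

/-! ### Estimates for ratios of Gamma values -/

theorem Real.Gamma_add_le_rpow_mul_Gamma {w a : ℝ} (hw : 0 < w) (ha : 0 ≤ a) (ha1 : a ≤ 1) :
    Real.Gamma (w + a) ≤ w ^ a * Real.Gamma w := by
  rcases ha.eq_or_lt with rfl | ha
  · simp
  rcases ha1.eq_or_lt with rfl | ha1
  · simp [Real.Gamma_add_one hw.ne']
  -- Log-convexity of Γ between w and w + 1, with weights 1 - a and a.
  have h := Real.Gamma_mul_add_mul_le_rpow_Gamma_mul_rpow_Gamma hw (by linarith : 0 < w + 1)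
    (by linarith : 0 < 1 - a) ha (by ring)
  rw [Real.Gamma_add_one hw.ne', Real.mul_rpow hw.le (Real.Gamma_pos_of_pos hw).le] at h
  have e : Real.Gamma w ^ (1 - a) * Real.Gamma w ^ a = Real.Gamma w := by
    rw [← Real.rpow_add (Real.Gamma_pos_of_pos hw)]; simp
  calc Real.Gamma (w + a) = Real.Gamma ((1 - a) * w + a * (w + 1)) := by ring_nf
    _ ≤ _ := h
    _ = w ^ a * (Real.Gamma w ^ (1 - a) * Real.Gamma w ^ a) := by ring
    _ = _ := by rw [e]

theorem Real.mul_Gamma_le_rpow_mul_Gamma_add {w a : ℝ} (hw : 0 < w) (ha : 0 ≤ a) (ha1 : a ≤ 1) :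
    w * Real.Gamma w ≤ (w + a) ^ (1 - a) * Real.Gamma (w + a) := by
  rw [← Real.Gamma_add_one hw.ne']
  have := Real.Gamma_add_le_rpow_mul_Gamma (w := w + a) (a := 1 - a) (by linarith)
    (by linarith) (by linarith)
  rwa [show w + a + (1 - a) = w + 1 by ring] at this

/-- The ratio `Γ(βx+1)/Γ(βx+1-α)`. -/
noncomputable def gammaRatio (α β x : ℝ) : ℝ :=
  Real.Gamma (β * x + 1) / Real.Gamma (β * x + 1 - α)

theorem gammaRatio_pos {α β x : ℝ} (h0 : 0 < β * x + 1) (h : 0 < β * x + 1 - α) :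
    0 < gammaRatio α β x :=
  div_pos (Real.Gamma_pos_of_pos h0) (Real.Gamma_pos_of_pos h)

theorem gammaRatio_le {α β x : ℝ} (hα : 0 ≤ α) (hα1 : α ≤ 1) (h : 0 < β * x + 1 - α) :
    gammaRatio α β x ≤ (β * x + 1 - α) ^ α := by
  rw [gammaRatio, div_le_iff₀ (Real.Gamma_pos_of_pos h)]
  simpa using Real.Gamma_add_le_rpow_mul_Gamma h hα hα1

theorem le_gammaRatio {α β x : ℝ} (hα : 0 ≤ α) (hα1 : α ≤ 1) (h : 0 < β * x + 1 - α) :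
    (β * x + 1 - α) * (β * x + 1) ^ (α - 1) ≤ gammaRatio α β x := by
  have h0 : 0 < β * x + 1 := by linarith
  rw [gammaRatio, le_div_iff₀ (Real.Gamma_pos_of_pos h)]
  have := Real.mul_Gamma_le_rpow_mul_Gamma_add h hα hα1
  rw [sub_add_cancel] at this
  calc _ = (β * x + 1) ^ (α - 1) * ((β * x + 1 - α) * Real.Gamma (β * x + 1 - α)) := by ring
    _ ≤ (β * x + 1) ^ (α - 1) * ((β * x + 1) ^ (1 - α) * Real.Gamma (β * x + 1)) := by gcongr
    _ = _ := by rw [← mul_assoc, ← Real.rpow_add h0]; simp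

theorem tendsto_gammaRatio_div_rpow {α β : ℝ} (hα : 0 ≤ α) (hα1 : α ≤ 1) (hβ : 0 < β) :
    Tendsto (fun x : ℝ => gammaRatio α β x / (β * x) ^ α) atTop (nhds 1) := by
  have hlin (d : ℝ) : Tendsto (fun x : ℝ => (β * x + d) / (β * x)) atTop (nhds 1) := by
    have h1 : Tendsto (fun x : ℝ => 1 + d / (β * x)) atTop (nhds (1 + 0)) :=
      tendsto_const_nhds.add ((tendsto_id.const_mul_atTop hβ).const_div_atTop d)
    rw [add_zero] at h1
    refine h1.congr' ?_
    filter_upwards [eventually_gt_atTop 0] with x hx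
    field_simp
  have hlo : Tendsto (fun x : ℝ => ((β * x + (1 - α)) / (β * x)) *
      ((β * x + 1) / (β * x)) ^ (α - 1)) atTop (nhds 1) := by
    simpa using (hlin (1 - α)).mul ((hlin 1).rpow_const (p := α - 1) (Or.inl one_ne_zero))
  have hhi : Tendsto (fun x : ℝ => ((β * x + (1 - α)) / (β * x)) ^ α) atTop (nhds 1) := by
    simpa using (hlin (1 - α)).rpow_const (p := α) (Or.inl one_ne_zero)
  refine tendsto_of_tendsto_of_tendsto_of_le_of_le' hlo hhi ?_ ?_
  · filter_upwards [eventually_gt_atTop 0] with x hx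
    have hb : 0 < β * x := mul_pos hβ hx
    rw [le_div_iff₀ (Real.rpow_pos_of_pos hb _)]
    refine le_trans (le_of_eq ?_) (le_gammaRatio hα hα1 (by linarith))
    rw [Real.div_rpow (by linarith) hb.le, Real.rpow_sub_one hb.ne']
    have := (Real.rpow_pos_of_pos hb α).ne'
    field_simp
    ring
  · filter_upwards [eventually_gt_atTop 0] with x hx
    have hb : 0 < β * x := mul_pos hβ hx
    rw [Real.div_rpow (by linarith) hb.le]
    gcongr
    have := gammaRatio_le (x := x) hα hα1 (by linarith : 0 < β * x + 1 - α)
    rwa [add_sub_assoc] at this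

/-- The form in which r(x) ~ (βx)^α is used: it removes the boundary factors of a telescoped
product. -/
theorem tendsto_gammaRatio_div_gammaRatio {α β : ℝ} (hα : 0 ≤ α) (hα1 : α ≤ 1) (hβ : 0 < β)
    (d : ℝ) :
    Tendsto (fun x : ℝ => gammaRatio α β x / gammaRatio α β (x + d)) atTop (nhds 1) := by
  have h1 := tendsto_gammaRatio_div_rpow hα hα1 hβ
  have hs : Tendsto (fun x : ℝ => x + d) atTop atTop := tendsto_atTop_add_const_right _ _ tendsto_id
  have h2 := h1.comp hs
  have h3 : Tendsto (fun x : ℝ => 1 - d / (x + d)) atTop (nhds (1 - 0)) :=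
    tendsto_const_nhds.sub (hs.const_div_atTop d)
  rw [sub_zero] at h3
  have h4 := (h1.div h2 one_ne_zero).mul (h3.rpow_const (p := α) (Or.inl one_ne_zero))
  simp only [Function.comp_def, div_one, Real.one_rpow, mul_one] at h4
  refine h4.congr' ?_
  filter_upwards [eventually_gt_atTop 0, hs.eventually_gt_atTop 0] with x hx hxd
  have e : 1 - d / (x + d) = (β * x) / (β * (x + d)) := by field_simp; ring
  have p1 : 0 < β * x := mul_pos hβ hx
  have p2 : 0 < β * (x + d) := mul_pos hβ hxd
  simp only [Pi.div_apply]
  rw [e, Real.div_rpow p1.le p2.le]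
  have := (Real.rpow_pos_of_pos p1 α).ne'
  have := (Real.rpow_pos_of_pos p2 α).ne'
  have := (gammaRatio_pos (α := α) (by linarith : 0 < β * (x + d) + 1) (by linarith)).ne'
  field_simp

/-! ### Growth of the moments -/

theorem Nat.factorial_add_le (n k : ℕ) :
    (n + k).factorial ≤ 2 ^ (n + k) * k.factorial * n.factorial := by
  rw [← Nat.add_choose_mul_factorial_mul_factorial n k, mul_assoc, mul_assoc,
    mul_comm n.factorial]
  gcongr
  exact Nat.choose_le_two_pow _ _

/-- Γ is not monotone near 0; a shift by 2 reaches [2, ∞), where it increases, at the cost of the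
factor x(x+1) ≥ c(c+1). -/
theorem Real.Gamma_le_mul_Gamma {c x y : ℝ} (hc : 0 < c) (hx : c ≤ x) (hxy : x + 2 ≤ y) :
    Real.Gamma x ≤ (c * (c + 1))⁻¹ * Real.Gamma y := by
  have hx0 : 0 < x := hc.trans_le hx
  have h1 : Real.Gamma (x + 2) = (x * (x + 1)) * Real.Gamma x := by
    rw [show x + 2 = x + 1 + 1 by ring, Real.Gamma_add_one (by linarith),
      Real.Gamma_add_one hx0.ne']
    ring
  have h2 : Real.Gamma (x + 2) ≤ Real.Gamma y :=
    Real.Gamma_strictMonoOn_Ici.monotoneOn (Set.mem_Ici.2 (by linarith))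
      (Set.mem_Ici.2 (by linarith)) hxy
  rw [inv_mul_eq_div, le_div_iff₀ (by positivity)]
  refine le_trans ?_ h2
  rw [h1, mul_comm]
  have := Real.Gamma_pos_of_pos hx0
  gcongr

theorem Real.Gamma_le_of_log_convex {α s t : ℝ} (hα : 0 ≤ α) (hα1 : α ≤ 1) (hs : 0 < s)
    (ht : 0 < t) :
    Real.Gamma (α * s + (1 - α) * t) ≤ Real.Gamma s ^ α * Real.Gamma t ^ (1 - α) := by
  rcases hα.eq_or_lt with rfl | hα
  · simp
  rcases hα1.eq_or_lt with rfl | hα1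
  · simp
  exact Real.Gamma_mul_add_mul_le_rpow_Gamma_mul_rpow_Gamma hs ht hα (by linarith) (by ring)

theorem genFactorial_eq (α β ν : ℝ) (n : ℕ) :
    genFactorial α β ν n = (∏ i ∈ Finset.Icc 1 n, gammaRatio α β i) *
      (Real.Gamma (β * n + (1 - α + ν)) / Real.Gamma (1 - α + ν)) := by
  simp only [genFactorial, gammaRatio, add_sub_assoc, add_assoc]

theorem gammaRatio_natCast_pos {α β : ℝ} (hα1 : α ≤ 1) (hβ : 0 < β) {i : ℕ}
    (hi : 1 ≤ i) : 0 < gammaRatio α β i := by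
  have : 0 < β * (i : ℝ) := by positivity
  exact gammaRatio_pos (by linarith) (by linarith)

theorem prod_gammaRatio_pos {α β : ℝ} (hα1 : α ≤ 1) (hβ : 0 < β) (n : ℕ) :
    0 < ∏ i ∈ Finset.Icc 1 n, gammaRatio α β i :=
  Finset.prod_pos fun _ hi => gammaRatio_natCast_pos hα1 hβ (Finset.mem_Icc.1 hi).1

theorem genFactorial_pos {α β ν : ℝ} (hα1 : α ≤ 1) (hβ : 0 < β) (hν : α - 1 < ν) (n : ℕ) :
    0 < genFactorial α β ν n := by
  rw [genFactorial_eq]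
  have hc : 0 < 1 - α + ν := by linarith
  have := Real.Gamma_pos_of_pos hc
  have := Real.Gamma_pos_of_pos (by positivity : 0 < β * n + (1 - α + ν))
  have := prod_gammaRatio_pos hα1 hβ n
  positivity

theorem Finset.prod_Icc_one_eq_prod_range {M : Type*} [CommMonoid M] (f : ℕ → M) (n : ℕ) :
    ∏ i ∈ Finset.Icc 1 n, f i = ∏ i ∈ Finset.range n, f (i + 1) := by
  rw [Finset.range_eq_Ico, Finset.prod_Ico_add' f 0 n 1, zero_add,
    Finset.Ico_add_one_right_eq_Icc]

theorem prod_gammaRatio_le {α β : ℝ} (hα : 0 ≤ α) (hα1 : α ≤ 1) (hβ : 0 < β) (hβ2 : β ≤ 2)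
    (n : ℕ) : ∏ i ∈ Finset.Icc 1 n, gammaRatio α β i ≤ (3 ^ n * n.factorial : ℝ) ^ α := by
  calc _ ≤ ∏ i ∈ Finset.Icc 1 n, (3 * (i : ℝ)) ^ α := by
        refine Finset.prod_le_prod (fun i hi => ?_) fun i hi => ?_
        · exact (gammaRatio_natCast_pos hα1 hβ (Finset.mem_Icc.1 hi).1).le
        · have h1 : (1 : ℝ) ≤ i := by exact_mod_cast (Finset.mem_Icc.1 hi).1
          have h2 : 0 < β * i := by positivity
          -- The 3 comes from βi + 1 - α ≤ 2i + 1 ≤ 3i.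
          refine (gammaRatio_le hα hα1 (by linarith)).trans ?_
          gcongr
          · linarith
          · nlinarith
    _ = (3 ^ n * n.factorial : ℝ) ^ α := by
        rw [Real.finsetProd_rpow _ _ (fun i _ => by positivity), Finset.prod_mul_distrib,
          Finset.prod_const, Nat.card_Icc, Nat.add_sub_cancel, ← Finset.prod_natCast,
          Finset.prod_Icc_one_eq_prod_range, Finset.prod_range_add_one_eq_factorial]

/-- Since β ≤ 2 - α = α·1 + (1-α)·2, log-convexity bounds Γ(βn+c) by n!^α (2n)!^(1-α), up to shifts
of the arguments. The product of ratios supplies another n!^α, and n!·n! ≤ (2n)!. -/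
theorem exists_genFactorial_le {α β ν : ℝ} (hα : 0 ≤ α) (hα1 : α ≤ 1) (hβ : 0 < β)
    (hν : α - 1 < ν) (hαβ : α + β ≤ 2) :
    ∃ A C : ℝ, 0 < C ∧
      ∀ n, genFactorial α β ν n ≤ A * C ^ n * ((2 * n).factorial : ℝ) := by
  set c := 1 - α + ν with hc
  have hc0 : 0 < c := by linarith
  -- K absorbs c and the gap of 2 required by `Real.Gamma_le_mul_Gamma`. The bases met below are 6
  -- and 4, so 12 is merely a convenient common bound.
  obtain ⟨K, hK⟩ := exists_nat_ge (c + 2)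
  have hG := Real.Gamma_pos_of_pos hc0
  refine ⟨(c * (c + 1))⁻¹ / Real.Gamma c * (K.factorial * 2 ^ K), 12, by norm_num,
    fun n => ?_⟩
  have hΓ : Real.Gamma (β * n + c) ≤ (c * (c + 1))⁻¹ *
      (((n + K).factorial : ℝ) ^ α * ((2 * n + K).factorial : ℝ) ^ (1 - α)) := by
    have h1 : Real.Gamma (β * n + c) ≤ (c * (c + 1))⁻¹ *
        Real.Gamma (α * ((n + K : ℕ) + 1) + (1 - α) * ((2 * n + K : ℕ) + 1)) := by
      refine Real.Gamma_le_mul_Gamma hc0 (by have := hβ; nlinarith [(by positivity : 0 ≤ β * n)]) ?_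
      push_cast
      have : (0 : ℝ) ≤ n * (2 - α - β) := mul_nonneg n.cast_nonneg (by linarith)
      nlinarith
    refine h1.trans ?_
    gcongr
    have := Real.Gamma_le_of_log_convex hα hα1 (s := (n + K : ℕ) + 1) (t := (2 * n + K : ℕ) + 1)
      (by positivity) (by positivity)
    simpa only [Real.Gamma_nat_eq_factorial] using this
  set Y : ℝ := (K.factorial * 2 ^ K) * 12 ^ n * (2 * n).factorial with hY
  have hX : (3 ^ n * n.factorial : ℝ) * (n + K).factorial ≤ Y := by
    have h1 : ((n + K).factorial : ℝ) ≤ 2 ^ (n + K) * K.factorial * n.factorial := by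
      exact_mod_cast Nat.factorial_add_le n K
    have h2 : (n.factorial * n.factorial : ℝ) ≤ (2 * n).factorial := by
      rw [two_mul]
      exact_mod_cast Nat.factorial_mul_factorial_dvd_factorial_add n n |> Nat.le_of_dvd
        (Nat.factorial_pos _)
    calc (3 ^ n * n.factorial : ℝ) * (n + K).factorial
        ≤ (3 ^ n * n.factorial : ℝ) * (2 ^ (n + K) * K.factorial * n.factorial) := by gcongr
      _ = (K.factorial * 2 ^ K) * 6 ^ n * (n.factorial * n.factorial) := by
        rw [pow_add, show (6 : ℝ) = 3 * 2 by norm_num, mul_pow]; ring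
      _ ≤ Y := by rw [hY]; gcongr; norm_num
  have hZ : ((2 * n + K).factorial : ℝ) ≤ Y := by
    have h1 : ((2 * n + K).factorial : ℝ) ≤ 2 ^ (2 * n + K) * K.factorial * (2 * n).factorial := by
      exact_mod_cast Nat.factorial_add_le (2 * n) K
    calc _ ≤ _ := h1
      _ = (K.factorial * 2 ^ K) * 4 ^ n * (2 * n).factorial := by
        rw [pow_add, pow_mul, show (2 : ℝ) ^ 2 = 4 by norm_num]; ring
      _ ≤ Y := by rw [hY]; gcongr; norm_num
  have hY0 : 0 < Y := by positivity
  rw [genFactorial_eq, ← hc]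
  have hα1' : 0 ≤ 1 - α := by linarith
  calc _ ≤ (3 ^ n * n.factorial : ℝ) ^ α * ((c * (c + 1))⁻¹ *
      (((n + K).factorial : ℝ) ^ α * ((2 * n + K).factorial : ℝ) ^ (1 - α)) / Real.Gamma c) := by
        have := prod_gammaRatio_le hα hα1 hβ (by linarith) n
        have := Real.Gamma_pos_of_pos (by positivity : 0 < β * n + c)
        gcongr
    _ = (c * (c + 1))⁻¹ / Real.Gamma c *
      (((3 ^ n * n.factorial : ℝ) * (n + K).factorial) ^ α *
        ((2 * n + K).factorial : ℝ) ^ (1 - α)) := by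
        rw [Real.mul_rpow (x := 3 ^ n * n.factorial) (by positivity) (by positivity)]; ring
    _ ≤ (c * (c + 1))⁻¹ / Real.Gamma c * (Y ^ α * Y ^ (1 - α)) := by gcongr
    _ = (c * (c + 1))⁻¹ / Real.Gamma c * Y := by
        rw [← Real.rpow_add hY0]; simp
    _ = _ := by rw [hY]; ring

/-! ### Determinacy via the symmetrised square root -/

open ProbabilityTheory in
-- The generating functions extend analytically to a vertical strip and agree there; the imaginary
-- axis carries the characteristic functions.
theorem MeasureTheory.Measure.ext_of_mgf_id_eq {μ μ' : Measure ℝ} [IsFiniteMeasure μ]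
    [IsFiniteMeasure μ'] (h : mgf id μ = mgf id μ') (h0 : μ = 0 ↔ μ' = 0)
    (hint : (0 : ℝ) ∈ interior (integrableExpSet id μ)) : μ = μ' := by
  refine Measure.ext_of_charFun (funext fun t => ?_)
  rw [← complexMGF_id_mul_I, ← complexMGF_id_mul_I]
  exact eqOn_complexMGF_of_mgf' h h0 (by simpa using hint)

/-- Evenness of cosh removes the root, so exponential moments of ±√x involve only integer moments of
x. -/
theorem Real.hasSum_cosh_mul_sqrt (t : ℝ) {x : ℝ} (hx : 0 ≤ x) :
    HasSum (fun n : ℕ => t ^ (2 * n) / (2 * n).factorial * x ^ n) (Real.cosh (t * √x)) := by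
  refine (Real.hasSum_cosh (t * √x)).congr_fun fun n => ?_
  rw [mul_pow, pow_mul √x, Real.sq_sqrt hx]
  ring

namespace IsStieltjesSolution

variable {m : ℕ → ℝ} {μ μ' : Measure ℝ}

theorem ae_nonneg (h : IsStieltjesSolution m μ) : ∀ᵐ x ∂μ, 0 ≤ x := by
  rw [ae_iff]
  simpa [Set.Iio_def] using h.support

theorem isFiniteMeasure (h : IsStieltjesSolution m μ) : IsFiniteMeasure μ := by
  have := h.integrable 0
  simp only [pow_zero] at this
  exact (integrable_const_iff_isFiniteMeasure one_ne_zero).1 this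

theorem lintegral_pow (h : IsStieltjesSolution m μ) (n : ℕ) :
    ∫⁻ x, ENNReal.ofReal (x ^ n) ∂μ = ENNReal.ofReal (m n) := by
  rw [← h.moment n, ofReal_integral_eq_lintegral_ofReal (h.integrable n)]
  filter_upwards [h.ae_nonneg] with x hx using pow_nonneg hx n

theorem lintegral_cosh_mul_sqrt (h : IsStieltjesSolution m μ) (t : ℝ) :
    ∫⁻ x, ENNReal.ofReal (Real.cosh (t * √x)) ∂μ =
      ∑' n : ℕ, ENNReal.ofReal (t ^ (2 * n) / (2 * n).factorial * m n) := by
  have ht (n : ℕ) : 0 ≤ t ^ (2 * n) / (2 * n).factorial := by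
    rw [pow_mul]; positivity
  calc _ = ∫⁻ x, ∑' n : ℕ, ENNReal.ofReal (t ^ (2 * n) / (2 * n).factorial) *
        ENNReal.ofReal (x ^ n) ∂μ := by
        refine lintegral_congr_ae ?_
        filter_upwards [h.ae_nonneg] with x hx
        have hs := Real.hasSum_cosh_mul_sqrt t hx
        rw [← hs.tsum_eq, ENNReal.ofReal_tsum_of_nonneg
          (fun n => mul_nonneg (ht n) (pow_nonneg hx n)) hs.summable]
        simp only [ENNReal.ofReal_mul (ht _)]
    _ = _ := by
        rw [lintegral_tsum (fun n => by fun_prop)]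
        refine tsum_congr fun n => ?_
        rw [lintegral_const_mul _ (by fun_prop), h.lintegral_pow, ← ENNReal.ofReal_mul (ht n)]

end IsStieltjesSolution

/-- The image of `μ` under `x ↦ ±√x`. -/
noncomputable def MeasureTheory.Measure.symmSqrt (μ : Measure ℝ) : Measure ℝ :=
  μ.map (fun x => √x) + μ.map (fun x => -√x)

instance (μ : Measure ℝ) [IsFiniteMeasure μ] : IsFiniteMeasure μ.symmSqrt := by
  unfold Measure.symmSqrt; infer_instance

namespace IsStieltjesSolution

variable {m : ℕ → ℝ} {μ μ' : Measure ℝ}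

theorem lintegral_exp_symmSqrt (h : IsStieltjesSolution m μ) (t : ℝ) :
    ∫⁻ y, ENNReal.ofReal (Real.exp (t * y)) ∂μ.symmSqrt =
      2 * ∑' n : ℕ, ENNReal.ofReal (t ^ (2 * n) / (2 * n).factorial * m n) := by
  rw [← h.lintegral_cosh_mul_sqrt, Measure.symmSqrt, lintegral_add_measure,
    lintegral_map (by fun_prop) (by fun_prop), lintegral_map (by fun_prop) (by fun_prop),
    ← lintegral_add_left (by fun_prop), ← lintegral_const_mul _ (by fun_prop)]
  refine lintegral_congr fun x => ?_
  rw [← ENNReal.ofReal_add (by positivity) (by positivity), ← ENNReal.ofReal_ofNat,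
    ← ENNReal.ofReal_mul (by norm_num), Real.cosh_eq, mul_neg]
  congr 1
  ring

theorem mgf_symmSqrt (h : IsStieltjesSolution m μ) (t : ℝ) :
    ProbabilityTheory.mgf id μ.symmSqrt t =
      (2 * ∑' n : ℕ, ENNReal.ofReal (t ^ (2 * n) / (2 * n).factorial * m n)).toReal := by
  rw [← h.lintegral_exp_symmSqrt, ProbabilityTheory.mgf,
    integral_eq_lintegral_of_nonneg_ae (Eventually.of_forall fun _ => (Real.exp_pos _).le)
      (by fun_prop)]
  rfl

/-- The factor (2n)! cancels, leaving a geometric series of ratio t²C. -/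
theorem zero_mem_interior_integrableExpSet (h : IsStieltjesSolution m μ) {A C : ℝ} (hC : 0 < C)
    (hm : ∀ n, m n ≤ A * C ^ n * ((2 * n).factorial : ℝ)) :
    (0 : ℝ) ∈ interior (ProbabilityTheory.integrableExpSet id μ.symmSqrt) := by
  rw [mem_interior_iff_mem_nhds]
  have hev : ∀ᶠ t : ℝ in nhds 0, t ^ 2 * C < 1 :=
    ContinuousAt.eventually_lt (by fun_prop) (by fun_prop) (by simp)
  filter_upwards [hev] with t ht
  refine ⟨by fun_prop, ?_⟩
  rw [hasFiniteIntegral_iff_ofReal (Eventually.of_forall fun _ => (Real.exp_pos _).le)]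
  have := h.lintegral_exp_symmSqrt t
  simp only [id]
  rw [this]
  refine ENNReal.mul_lt_top (by simp) (lt_of_le_of_lt
    (ENNReal.tsum_le_tsum (g := fun n => ENNReal.ofReal (A * (t ^ 2 * C) ^ n)) fun n => ?_) ?_)
  · refine ENNReal.ofReal_le_ofReal ?_
    have hf : (0 : ℝ) < (2 * n).factorial := by positivity
    calc _ ≤ t ^ (2 * n) / (2 * n).factorial * (A * C ^ n * ((2 * n).factorial : ℝ)) := by
          have := hm n
          have : 0 ≤ t ^ (2 * n) := by rw [pow_mul]; positivity
          gcongr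
      _ = _ := by rw [mul_pow, ← pow_mul]; field_simp
  · have hs : Summable fun n : ℕ => A * (t ^ 2 * C) ^ n :=
      (summable_geometric_of_lt_one (by positivity) ht).mul_left A
    exact hs.tsum_ofReal_lt_top

theorem map_sq_symmSqrt (h : IsStieltjesSolution m μ) :
    μ.symmSqrt.map (fun y => y ^ 2) = μ + μ := by
  rw [Measure.symmSqrt, Measure.map_add _ _ (by fun_prop), Measure.map_map (by fun_prop)
    (by fun_prop), Measure.map_map (by fun_prop) (by fun_prop)]
  have e (f : ℝ → ℝ) (hf : ∀ x, 0 ≤ x → f x = x) : μ.map f = μ := by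
    conv_rhs => rw [← Measure.map_id (μ := μ)]
    refine Measure.map_congr ?_
    filter_upwards [h.ae_nonneg] with x hx using hf x hx
  rw [e _ fun x hx => by simp [Real.sq_sqrt hx], e _ fun x hx => by simp [Real.sq_sqrt hx]]

theorem ext (h : IsStieltjesSolution m μ) (h' : IsStieltjesSolution m μ') {A C : ℝ} (hC : 0 < C)
    (hm : ∀ n, m n ≤ A * C ^ n * ((2 * n).factorial : ℝ)) : μ = μ' := by
  have := h.isFiniteMeasure
  have := h'.isFiniteMeasure
  -- Equal masses give the equivalence μ = 0 ↔ μ' = 0 needed for the images.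
  have hmass : μ.symmSqrt Set.univ = μ'.symmSqrt Set.univ := by
    have h1 := h.lintegral_exp_symmSqrt 0
    have h2 := h'.lintegral_exp_symmSqrt 0
    simp only [zero_mul, Real.exp_zero, ENNReal.ofReal_one, lintegral_one] at h1 h2
    rw [h1, h2]
  have heq : μ.symmSqrt = μ'.symmSqrt := by
    refine Measure.ext_of_mgf_id_eq (funext fun t => ?_) ?_
      (h.zero_mem_interior_integrableExpSet hC hm)
    · rw [h.mgf_symmSqrt, h'.mgf_symmSqrt]
    · rw [← Measure.measure_univ_eq_zero, hmass, Measure.measure_univ_eq_zero]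
  have hsum : μ + μ = μ' + μ' := by rw [← h.map_sq_symmSqrt, ← h'.map_sq_symmSqrt, heq]
  ext s
  have := congrArg (fun κ : Measure ℝ => κ s) hsum
  simp only [Measure.add_apply, ← two_mul] at this
  exact (ENNReal.mul_right_inj (by simp) (by simp)).1 this

end IsStieltjesSolution

/-! ### Carleman's condition -/

theorem tendsto_sum_rpow_atTop_of_le_factorial {m : ℕ → ℝ} (hpos : ∀ n, 0 < m n) {A C : ℝ}
    (hC : 0 ≤ C) (hm : ∀ n, m n ≤ A * C ^ n * ((2 * n).factorial : ℝ)) :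
    Tendsto (fun N : ℕ => ∑ n ∈ Finset.Icc 1 N, m n ^ (-(1 / (2 * (n : ℝ))))) atTop atTop := by
  -- Chosen so that m n ≤ (Bn)²ⁿ for n ≥ 1: the 2 comes from (2n)! ≤ (2n)²ⁿ, and the maxima allow A
  -- and Cⁿ to be raised to 2n-th powers.
  set B : ℝ := 2 * max A 1 * max C 1 with hB
  have hA1 : 1 ≤ max A 1 := le_max_right _ _
  have hC1 : 1 ≤ max C 1 := le_max_right _ _
  have hB0 : 0 < B := by positivity
  have hle (n : ℕ) (hn : 1 ≤ n) : m n ≤ (B * n) ^ (2 * n) := by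
    calc m n ≤ A * C ^ n * ((2 * n).factorial : ℝ) := hm n
      _ ≤ (max A 1) ^ (2 * n) * (max C 1) ^ (2 * n) * ((2 * n : ℕ) : ℝ) ^ (2 * n) := by
        gcongr
        · exact (le_max_left A 1).trans (le_self_pow₀ hA1 (by omega))
        · calc C ^ n ≤ (max C 1) ^ n := by gcongr; exact le_max_left _ _
            _ ≤ _ := pow_le_pow_right₀ hC1 (by omega)
        · exact_mod_cast Nat.factorial_le_pow _
      _ = (B * n) ^ (2 * n) := by rw [hB]; push_cast; simp only [mul_pow]; ring
  have hge (n : ℕ) (hn : 1 ≤ n) : B⁻¹ * (1 / (n : ℝ)) ≤ m n ^ (-(1 / (2 * (n : ℝ)))) := by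
    have hn0 : (0 : ℝ) < n := by exact_mod_cast hn
    calc B⁻¹ * (1 / (n : ℝ)) = ((B * n) ^ (2 * n)) ^ (-(1 / (2 * (n : ℝ)))) := by
          rw [← Real.rpow_natCast, ← Real.rpow_mul (by positivity)]
          push_cast
          rw [show 2 * (n : ℝ) * -(1 / (2 * n)) = -1 by field_simp, Real.rpow_neg_one, mul_inv B,
            one_div]
      _ ≤ _ := Real.rpow_le_rpow_of_nonpos (hpos n) (hle n hn)
          (neg_nonpos.2 (by positivity))
  refine tendsto_atTop_mono (fun N => Finset.sum_le_sum fun n hn => hge n (Finset.mem_Icc.1 hn).1) ?_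
  simp_rw [← Finset.mul_sum]
  refine Tendsto.const_mul_atTop (by positivity) ?_
  refine Real.tendsto_sum_range_one_div_nat_succ_atTop.congr fun N => ?_
  rw [Finset.range_eq_Ico]
  have := Finset.sum_Ico_add' (fun i : ℕ => 1 / (i : ℝ)) 0 N 1
  rw [zero_add, Finset.Ico_add_one_right_eq_Icc] at this
  rw [← this]
  push_cast
  rfl

/-! ### Weak limits on the logarithmic scale -/

/-- The bounded continuous function `y ↦ min (exp (m * y)) K`. -/
noncomputable def truncatedExp (m : ℝ) (K : ℕ) : ℝ →ᵇ ℝ≥0 :=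
  BoundedContinuousFunction.mkOfBound
    ⟨fun y => min (Real.exp (m * y)).toNNReal K, by fun_prop⟩ K fun x y => by
      rw [NNReal.dist_eq]
      exact abs_sub_le_of_nonneg_of_le (NNReal.coe_nonneg _)
        (by exact_mod_cast min_le_right _ _) (NNReal.coe_nonneg _)
        (by exact_mod_cast min_le_right _ _)

theorem coe_truncatedExp (m : ℝ) (K : ℕ) (y : ℝ) :
    (truncatedExp m K y : ℝ≥0∞) = min (ENNReal.ofReal (Real.exp (m * y))) K := by
  change ((min (Real.exp (m * y)).toNNReal (K : ℝ≥0) : ℝ≥0) : ℝ≥0∞) = _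
  rw [ENNReal.coe_min, ENNReal.coe_natCast]
  rfl

/-- Controls the loss from truncation at K by a second moment, so that no mass of the m-th moment
escapes in the limit. -/
theorem ENNReal.le_min_add_inv_mul_sq (a : ℝ≥0∞) {K : ℕ} (hK : K ≠ 0) :
    a ≤ min a K + (K : ℝ≥0∞)⁻¹ * a ^ 2 := by
  rcases le_total a K with h | h
  · rw [min_eq_left h]; exact le_self_add
  · refine le_trans ?_ le_add_self
    rw [sq, ← mul_assoc]
    refine le_mul_of_one_le_left zero_le ?_
    rw [← ENNReal.inv_mul_cancel (a := (K : ℝ≥0∞)) (by exact_mod_cast hK) (by simp)]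
    gcongr

/-- Chernoff's bound on both tails. -/
theorem isTightMeasureSet_range_of_lintegral_exp_le {ι : Type*} (τ : ι → Measure ℝ)
    {D E : ℝ≥0∞} (hD : D ≠ ∞) (hE : E ≠ ∞)
    (h1 : ∀ i, ∫⁻ y, ENNReal.ofReal (Real.exp y) ∂τ i ≤ D)
    (h2 : ∀ i, ∫⁻ y, ENNReal.ofReal (Real.exp (-y)) ∂τ i ≤ E) :
    IsTightMeasureSet (Set.range τ) := by
  refine isTightMeasureSet_of_tendsto_measure_norm_gt ?_
  have hlim : Tendsto (fun r : ℝ => ENNReal.ofReal (Real.exp (-r)) * (D + E)) atTop (𝓝 0) := by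
    have h := ENNReal.tendsto_ofReal Real.tendsto_exp_neg_atTop_nhds_zero
    simpa using ENNReal.Tendsto.mul_const h (b := D + E)
      (Or.inr (ENNReal.add_ne_top.2 ⟨hD, hE⟩))
  refine tendsto_of_tendsto_of_tendsto_of_le_of_le tendsto_const_nhds hlim
    (fun _ => zero_le) fun r => ?_
  refine iSup₂_le ?_
  rintro _ ⟨i, rfl⟩
  have hm : ENNReal.ofReal (Real.exp r) * τ i {y | r < ‖y‖} ≤ D + E := by
    calc _ ≤ ENNReal.ofReal (Real.exp r) * τ i {y | ENNReal.ofReal (Real.exp r) ≤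
          ENNReal.ofReal (Real.exp y) + ENNReal.ofReal (Real.exp (-y))} := by
          refine mul_le_mul_right (measure_mono fun y hy => ?_) _
          simp only [Set.mem_ofPred_eq, Real.norm_eq_abs] at hy ⊢
          rcases lt_abs.1 hy with h | h
          · exact le_add_right (ENNReal.ofReal_le_ofReal (Real.exp_le_exp.2 h.le))
          · exact le_add_left (ENNReal.ofReal_le_ofReal (Real.exp_le_exp.2 h.le))
      _ ≤ ∫⁻ y, (ENNReal.ofReal (Real.exp y) + ENNReal.ofReal (Real.exp (-y))) ∂τ i :=
          mul_meas_ge_le_lintegral (by fun_prop) _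
      _ ≤ D + E := by
          rw [lintegral_add_left (by fun_prop)]
          exact add_le_add (h1 i) (h2 i)
  calc τ i {y | r < ‖y‖} = ENNReal.ofReal (Real.exp (-r)) *
        (ENNReal.ofReal (Real.exp r) * τ i {y | r < ‖y‖}) := by
        rw [← mul_assoc, ← ENNReal.ofReal_mul (Real.exp_pos _).le, ← Real.exp_add]
        simp
    _ ≤ _ := by gcongr

/-- A sequence of laws on the logarithmic scale, with convergent moments and a bounded moment of
order `-1`, has a limit law with the limit moments. -/
theorem exists_probabilityMeasure_of_tendsto_moment (τ : ℕ → ProbabilityMeasure ℝ)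
    {M : ℕ → ℕ → ℝ} {L : ℕ → ℝ} {E : ℝ≥0∞} (hE : E ≠ ∞)
    (hM : ∀ n (m : ℕ), ∫⁻ y, ENNReal.ofReal (Real.exp (m * y)) ∂(τ n : Measure ℝ) =
      ENNReal.ofReal (M n m))
    (hneg : ∀ n, ∫⁻ y, ENNReal.ofReal (Real.exp (-y)) ∂(τ n : Measure ℝ) ≤ E)
    (hL : ∀ m, Tendsto (fun n => M n m) atTop (𝓝 (L m))) :
    ∃ ρ : ProbabilityMeasure ℝ, ∀ m : ℕ,
      ∫⁻ y, ENNReal.ofReal (Real.exp (m * y)) ∂(ρ : Measure ℝ) = ENNReal.ofReal (L m) := by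
  have htight : IsTightMeasureSet (Set.range fun n => (τ n : Measure ℝ)) := by
    obtain ⟨D, hD⟩ := (hL 1).bddAbove_range
    refine isTightMeasureSet_range_of_lintegral_exp_le _ (D := ENNReal.ofReal D)
      ENNReal.ofReal_ne_top hE (fun n => ?_) hneg
    have := hM n 1
    simp only [Nat.cast_one, one_mul] at this
    rw [this]
    exact ENNReal.ofReal_le_ofReal (hD ⟨n, rfl⟩)
  have hcpt : IsCompact (closure (Set.range τ)) := by
    refine isCompact_closure_of_isTightMeasureSet ?_
    convert! htight
    ext; simp
  -- Prokhorov: by compactness the sequence converges along a free ultrafilter, which replaces a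
  -- subsequence.
  obtain ⟨ρ, -, hρ⟩ := hcpt.ultrafilter_le_nhds ((hyperfilter ℕ).map τ)
    (by
      rw [Ultrafilter.coe_map, le_principal_iff, mem_map]
      exact univ_mem' fun n => subset_closure ⟨n, rfl⟩)
  have hle : (hyperfilter ℕ : Filter ℕ) ≤ atTop := by
    rw [← Nat.cofinite_eq_atTop]; exact hyperfilter_le_cofinite
  have hweak := ProbabilityMeasure.tendsto_iff_forall_lintegral_tendsto.1
    (show Tendsto τ (hyperfilter ℕ) (𝓝 ρ) from hρ)
  have htr (m : ℕ) (K : ℕ) := hweak (truncatedExp m K)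
  simp only [coe_truncatedExp] at htr
  have hML (m : ℕ) := (ENNReal.tendsto_ofReal (hL m)).mono_left hle
  refine ⟨ρ, fun m => le_antisymm ?_ ?_⟩
  -- Upper bound: weak convergence of the truncations, then monotone convergence in K.
  · have hsup : ∫⁻ y, ENNReal.ofReal (Real.exp (m * y)) ∂(ρ : Measure ℝ) =
        ⨆ K : ℕ, ∫⁻ y, min (ENNReal.ofReal (Real.exp (m * y))) K ∂(ρ : Measure ℝ) := by
      rw [← lintegral_iSup (fun K => by fun_prop)]
      · refine lintegral_congr fun y => ?_
        rw [← inf_iSup_eq, ENNReal.iSup_natCast, inf_top_eq]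
      · intro K K' h y
        dsimp only
        gcongr
    rw [hsup]
    refine iSup_le fun K => le_of_tendsto_of_tendsto (htr m K) (hML m)
      (Eventually.of_forall fun n => ?_)
    simp only [← hM n m]
    exact lintegral_mono fun y => min_le_left _ _
  -- Lower bound: the truncation error is at most K⁻¹ times the moment of order 2m.
  · have hK (K : ℕ) (h0 : K ≠ 0) : ENNReal.ofReal (L m) ≤
        ∫⁻ y, ENNReal.ofReal (Real.exp (m * y)) ∂(ρ : Measure ℝ) +
          (K : ℝ≥0∞)⁻¹ * ENNReal.ofReal (L (2 * m)) := by
      have hlim := (htr m K).add (ENNReal.Tendsto.const_mul (a := (K : ℝ≥0∞)⁻¹) (hML (2 * m))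
        (Or.inr (by simpa using h0)))
      refine (le_of_tendsto_of_tendsto (hML m) hlim (Eventually.of_forall fun n => ?_)).trans ?_
      · simp only [← hM n]
        rw [← lintegral_const_mul _ (by fun_prop), ← lintegral_add_left (by fun_prop)]
        refine lintegral_mono fun y => ?_
        refine (ENNReal.le_min_add_inv_mul_sq _ h0).trans (le_of_eq ?_)
        rw [← ENNReal.ofReal_pow (Real.exp_pos _).le, ← Real.exp_nat_mul]
        push_cast
        ring_nf
      · gcongr
        exact min_le_left _ _
    have hlim : Tendsto (fun K : ℕ => ∫⁻ y, ENNReal.ofReal (Real.exp (m * y)) ∂(ρ : Measure ℝ) +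
        (K : ℝ≥0∞)⁻¹ * ENNReal.ofReal (L (2 * m))) atTop
        (𝓝 (∫⁻ y, ENNReal.ofReal (Real.exp (m * y)) ∂(ρ : Measure ℝ))) := by
      simpa using tendsto_const_nhds.add (ENNReal.Tendsto.mul_const
        ENNReal.tendsto_inv_nat_nhds_zero (b := ENNReal.ofReal (L (2 * m))) (by simp))
    refine ge_of_tendsto hlim ?_
    filter_upwards [eventually_ne_atTop 0] with K h0 using hK K h0

/-! ### Laws whose moments are products of Gamma ratios -/

open ProbabilityTheory in
-- The factor x^s shifts the first parameter of the density, leaving the ratio of normalising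
-- constants.
theorem lintegral_exp_mul_log_betaMeasure {a b s : ℝ} (ha : 0 < a) (hb : 0 < b)
    (has : 0 < a + s) :
    ∫⁻ x, ENNReal.ofReal (Real.exp (s * Real.log x)) ∂betaMeasure a b =
      ENNReal.ofReal (beta (a + s) b / beta a b) := by
  have hmeas (a : ℝ) : Measurable (betaPDF a b) := (measurable_betaPDFReal a b).ennreal_ofReal
  have hB := beta_pos ha hb
  have hB' := beta_pos has hb
  rw [betaMeasure, lintegral_withDensity_eq_lintegral_mul _ (hmeas a) (by fun_prop)]
  calc _ = ∫⁻ x, ENNReal.ofReal (beta (a + s) b / beta a b) * betaPDF (a + s) b x := by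
        refine lintegral_congr fun x => ?_
        rw [Pi.mul_apply]
        by_cases hx : 0 < x ∧ x < 1
        · rw [betaPDF_of_pos_lt_one hx.1 hx.2, betaPDF_of_pos_lt_one hx.1 hx.2,
            mul_comm s, ← Real.rpow_def_of_pos hx.1,
            ← ENNReal.ofReal_mul' (Real.rpow_nonneg hx.1.le _),
            ← ENNReal.ofReal_mul (p := beta (a + s) b / beta a b) (by positivity)]
          congr 1
          rw [show a + s - 1 = (a - 1) + s by ring, Real.rpow_add hx.1]
          field_simp
        · simp [betaPDF_eq, hx]
    _ = _ := by
        rw [lintegral_const_mul _ (hmeas _), lintegral_betaPDF_eq_one has hb, mul_one]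

open ProbabilityTheory in
theorem lintegral_exp_mul_log_gammaMeasure {a s : ℝ} (ha : 0 < a) (has : 0 < a + s) :
    ∫⁻ x, ENNReal.ofReal (Real.exp (s * Real.log x)) ∂gammaMeasure a 1 =
      ENNReal.ofReal (Real.Gamma (a + s) / Real.Gamma a) := by
  have hmeas (a : ℝ) : Measurable (gammaPDF a 1) := (measurable_gammaPDFReal a 1).ennreal_ofReal
  have hG := Real.Gamma_pos_of_pos ha
  have hG' := Real.Gamma_pos_of_pos has
  rw [gammaMeasure, lintegral_withDensity_eq_lintegral_mul _ (hmeas a) (by fun_prop)]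
  calc _ = ∫⁻ x, ENNReal.ofReal (Real.Gamma (a + s) / Real.Gamma a) * gammaPDF (a + s) 1 x := by
        refine lintegral_congr_ae ?_
        -- The convention log 0 = 0 can break the identity at this one point.
        filter_upwards [Measure.ae_ne volume (0 : ℝ)] with x hx0
        rw [Pi.mul_apply]
        rcases lt_or_gt_of_ne hx0 with hx | hx
        · rw [gammaPDF_of_neg hx, gammaPDF_of_neg hx, zero_mul, mul_zero]
        · rw [gammaPDF_of_nonneg hx.le, gammaPDF_of_nonneg hx.le,
            mul_comm s, ← Real.rpow_def_of_pos hx,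
            ← ENNReal.ofReal_mul' (Real.rpow_nonneg hx.le _),
            ← ENNReal.ofReal_mul (p := Real.Gamma (a + s) / Real.Gamma a) (by positivity)]
          congr 1
          rw [show a + s - 1 = (a - 1) + s by ring, Real.rpow_add hx]
          simp only [Real.one_rpow]
          field_simp
    _ = _ := by
        rw [lintegral_const_mul _ (hmeas _), lintegral_gammaPDF_eq_one has one_pos, mul_one]

/-- The law of `∑ k ∈ {1, …, n}, β log Bₖ` for independent `Bₖ` with law `Beta(βk + 1 - α, α)`. -/
theorem exists_isProbabilityMeasure_lintegral_exp_eq_prod {α β : ℝ} (hα : 0 < α) (hα1 : α < 1)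
    (hβ : 0 < β) (n : ℕ) :
    ∃ σ : Measure ℝ, IsProbabilityMeasure σ ∧ ∀ z : ℝ, -1 ≤ z →
      ∫⁻ y, ENNReal.ofReal (Real.exp (z * y)) ∂σ = ENNReal.ofReal
        (∏ k ∈ Finset.range n, gammaRatio α β (k + 1) / gammaRatio α β (k + 1 + z)) := by
  induction n with
  | zero => exact ⟨Measure.dirac 0, inferInstance, fun z _ => by simp⟩
  | succ n ih =>
    obtain ⟨σ, hσ, h⟩ := ih
    set a := β * (n + 1) + 1 - α with ha
    have hbn : 0 ≤ β * (n : ℝ) := by positivity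
    have ha0 : 0 < a := by rw [ha]; linarith
    have := ProbabilityTheory.isProbabilityMeasureBeta ha0 hα
    set κ := (ProbabilityTheory.betaMeasure a α).map fun x => β * Real.log x with hκ
    have hκp : IsProbabilityMeasure κ := Measure.isProbabilityMeasure_map (by fun_prop)
    refine ⟨σ.conv κ, inferInstance, fun z hz => ?_⟩
    -- z ≥ -1 keeps a + βz ≥ 1 - α > 0; the value z = -1 serves for tightness.
    have hbz : 0 ≤ β * (z + 1) := mul_nonneg hβ.le (by linarith)
    have haz : 0 < a + β * z := by rw [ha]; linarith
    have hκz : ∫⁻ y, ENNReal.ofReal (Real.exp (z * y)) ∂κ =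
        ENNReal.ofReal (gammaRatio α β (n + 1) / gammaRatio α β (n + 1 + z)) := by
      rw [hκ, lintegral_map (by fun_prop) (by fun_prop)]
      have := lintegral_exp_mul_log_betaMeasure ha0 hα haz
      simp only [← mul_assoc, mul_comm z β]
      rw [this, gammaRatio, gammaRatio, ProbabilityTheory.beta, ProbabilityTheory.beta,
        show β * (n + 1 + z) + 1 - α = a + β * z by rw [ha]; ring, ← ha,
        show β * (n + 1 + z) + 1 = a + β * z + α by rw [ha]; ring,
        show β * (n + 1 : ℝ) + 1 = a + α by rw [ha]; ring]
      have h1 := Real.Gamma_pos_of_pos ha0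
      have h2 := Real.Gamma_pos_of_pos haz
      have h3 := Real.Gamma_pos_of_pos hα
      have h4 := Real.Gamma_pos_of_pos (add_pos ha0 hα)
      have h5 := Real.Gamma_pos_of_pos (add_pos haz hα)
      congr 1
      field_simp
    rw [Measure.lintegral_conv (by fun_prop), Finset.prod_range_succ, ENNReal.ofReal_mul, ← h z hz,
      ← hκz, ← lintegral_mul_const _ (by fun_prop)]
    · refine lintegral_congr fun x => ?_
      rw [← lintegral_const_mul _ (by fun_prop)]
      refine lintegral_congr fun y => ?_
      rw [← ENNReal.ofReal_mul (Real.exp_pos _).le, ← Real.exp_add, mul_add]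
    · refine Finset.prod_nonneg fun k _ => ?_
      have h0 : 0 ≤ β * (k : ℝ) := by positivity
      exact div_nonneg (gammaRatio_pos (by linarith) (by linarith)).le
        (gammaRatio_pos (by linarith) (by linarith)).le

/-- Splitting r(1)⋯r(n+m) after n or after m factors trades n quotients for m of them, each of the
form r(j+1)·r(n)/r(n+j+1). -/
theorem tendsto_pow_mul_prod_gammaRatio {α β : ℝ} (hα : 0 ≤ α) (hα1 : α < 1) (hβ : 0 < β)
    (m : ℕ) :
    Tendsto (fun n : ℕ => gammaRatio α β n ^ m *
      ∏ k ∈ Finset.range n, gammaRatio α β (k + 1) / gammaRatio α β (k + 1 + m)) atTop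
      (𝓝 (∏ i ∈ Finset.Icc 1 m, gammaRatio α β i)) := by
  have hpos (x : ℝ) (hx : 0 ≤ x) : gammaRatio α β x ≠ 0 := by
    have h0 : 0 ≤ β * x := by positivity
    exact (gammaRatio_pos (by linarith) (by linarith)).ne'
  have key (n : ℕ) : gammaRatio α β n ^ m *
      ∏ k ∈ Finset.range n, gammaRatio α β (k + 1) / gammaRatio α β (k + 1 + m) =
      ∏ j ∈ Finset.range m, gammaRatio α β (j + 1) *
        (gammaRatio α β n / gammaRatio α β (n + (j + 1))) := by
    have h1 := Finset.prod_range_add (fun k : ℕ => gammaRatio α β (k + 1)) m n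
    have h2 := Finset.prod_range_add (fun k : ℕ => gammaRatio α β (k + 1)) n m
    rw [add_comm n m, h1] at h2
    simp only [Finset.prod_mul_distrib, Finset.prod_div_distrib, Finset.prod_const,
      Finset.card_range]
    push_cast at h2
    have e1 (k : ℕ) : (m : ℝ) + k + 1 = k + 1 + m := by ring
    have e2 (k : ℕ) : (n : ℝ) + k + 1 = n + (k + 1) := by ring
    simp only [e1, e2] at h2
    have d1 : ∏ k ∈ Finset.range n, gammaRatio α β (k + 1 + m) ≠ 0 :=
      Finset.prod_ne_zero_iff.2 fun k _ => hpos _ (by positivity)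
    have d2 : ∏ j ∈ Finset.range m, gammaRatio α β (n + (j + 1)) ≠ 0 :=
      Finset.prod_ne_zero_iff.2 fun k _ => hpos _ (by positivity)
    field_simp
    linear_combination -gammaRatio α β n ^ m * h2
  simp only [key]
  rw [Finset.prod_Icc_one_eq_prod_range]
  refine tendsto_finsetProd _ fun j _ => ?_
  have := (tendsto_gammaRatio_div_gammaRatio hα hα1.le hβ (j + 1)).comp
    (tendsto_natCast_atTop_atTop (R := ℝ))
  simpa using this.const_mul (gammaRatio α β (j + 1))

/-- The endpoints are explicit: a point mass for α = 0, and for α = 1, where r(i) = βi, the law of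
log(βG) with G exponential. The Beta construction excludes them: it needs α > 0, and its moment
bound Γ(1-α) needs α < 1. -/
theorem exists_probabilityMeasure_moment_eq_prod_gammaRatio {α β : ℝ} (hα : 0 ≤ α) (hα1 : α ≤ 1)
    (hβ : 0 < β) :
    ∃ ρ : ProbabilityMeasure ℝ, ∀ m : ℕ,
      ∫⁻ y, ENNReal.ofReal (Real.exp (m * y)) ∂(ρ : Measure ℝ) =
        ENNReal.ofReal (∏ i ∈ Finset.Icc 1 m, gammaRatio α β i) := by
  rcases hα.eq_or_lt with rfl | hα
  · refine ⟨⟨Measure.dirac 0, inferInstance⟩, fun m => ?_⟩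
    rw [Finset.prod_eq_one]
    · simp
    · intro i _
      rw [gammaRatio, sub_zero, div_self (Real.Gamma_pos_of_pos (by positivity)).ne']
  rcases hα1.eq_or_lt with rfl | hα1
  · have := ProbabilityTheory.isProbabilityMeasure_gammaMeasure one_pos one_pos
    refine ⟨⟨(ProbabilityTheory.gammaMeasure 1 1).map fun x => Real.log x + Real.log β,
      Measure.isProbabilityMeasure_map (by fun_prop)⟩, fun m => ?_⟩
    simp only [ProbabilityMeasure.coe_mk]
    rw [lintegral_map (by fun_prop) (by fun_prop)]
    simp only [mul_add, Real.exp_add]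
    simp only [ENNReal.ofReal_mul (Real.exp_pos _).le]
    rw [lintegral_mul_const _ (by fun_prop),
      lintegral_exp_mul_log_gammaMeasure one_pos (by positivity),
      ← ENNReal.ofReal_mul' (Real.exp_pos _).le, Real.exp_nat_mul, Real.exp_log hβ, add_comm,
      Real.Gamma_nat_eq_factorial, Real.Gamma_one, div_one,
      ← Finset.prod_range_add_one_eq_factorial, ← Finset.prod_Icc_one_eq_prod_range (fun i => i)]
    congr 1
    push_cast
    have hcard : β ^ m = ∏ i ∈ Finset.Icc 1 m, β := by simp
    rw [hcard, ← Finset.prod_mul_distrib]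
    refine Finset.prod_congr rfl fun i hi => ?_
    have hi : (0 : ℝ) < i := by exact_mod_cast (Finset.mem_Icc.1 hi).1
    have hb : 0 < β * i := by positivity
    rw [gammaRatio, add_sub_cancel_right, Real.Gamma_add_one hb.ne', mul_div_assoc,
      div_self (Real.Gamma_pos_of_pos hb).ne']
    ring
  choose σ hσ h using fun n => exists_isProbabilityMeasure_lintegral_exp_eq_prod hα hα1 hβ n
  have hpos (x : ℝ) (hx : 0 ≤ x) : 0 < gammaRatio α β x := by
    have h0 : 0 ≤ β * x := by positivity
    exact gammaRatio_pos (by linarith) (by linarith)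
  have hz (n : ℕ) (z : ℝ) (h1 : -1 ≤ z) :
      ∫⁻ y, ENNReal.ofReal (Real.exp (z * y))
        ∂(σ n).map (fun y => Real.log (gammaRatio α β n) + y) =
      ENNReal.ofReal (Real.exp (z * Real.log (gammaRatio α β n)) *
        ∏ k ∈ Finset.range n, gammaRatio α β (k + 1) / gammaRatio α β (k + 1 + z)) := by
    rw [lintegral_map (by fun_prop) (by fun_prop), ENNReal.ofReal_mul (Real.exp_pos _).le,
      ← h n z h1, ← lintegral_const_mul _ (by fun_prop)]
    refine lintegral_congr fun y => ?_
    rw [← ENNReal.ofReal_mul (Real.exp_pos _).le, ← Real.exp_add, mul_add]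
  refine exists_probabilityMeasure_of_tendsto_moment
    (fun n => ⟨(σ n).map (fun y => Real.log (gammaRatio α β n) + y),
      Measure.isProbabilityMeasure_map (by fun_prop)⟩)
    (E := ENNReal.ofReal (1 / gammaRatio α β 0)) ENNReal.ofReal_ne_top
    (fun n m => hz n m (by linarith [m.cast_nonneg (α := ℝ)])) (fun n => ?_) fun m => ?_
  -- At order -1 the product telescopes to r(n)/r(0), and the normalisation cancels r(n): the bound
  -- 1/r(0) is uniform in n.
  · have := hz n (-1) le_rfl
    simp only [neg_one_mul] at this
    simp only [ProbabilityMeasure.coe_mk]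
    rw [this]
    refine ENNReal.ofReal_le_ofReal (le_of_eq ?_)
    have hp : ∏ k ∈ Finset.range n, gammaRatio α β (k + 1) / gammaRatio α β k =
        gammaRatio α β n / gammaRatio α β 0 := by
      refine Finset.prod_range_induction _ (fun n : ℕ => gammaRatio α β n / gammaRatio α β 0)
        (by simp [(hpos 0 le_rfl).ne']) n fun k _ => ?_
      have := (hpos k (by positivity)).ne'
      push_cast
      field_simp
    simp only [← sub_eq_add_neg, add_sub_cancel_right]
    rw [hp, Real.exp_neg, Real.exp_log (hpos _ (by positivity))]
    have := (hpos n (by positivity)).ne'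
    field_simp
  · refine (tendsto_pow_mul_prod_gammaRatio hα.le hα1 hβ m).congr fun n => ?_
    rw [Real.exp_nat_mul, Real.exp_log (hpos _ (by positivity))]

/-! ### Weight functions as solutions -/

namespace IsStieltjesWeight

variable {m : ℕ → ℝ} {U V : ℝ → ℝ}

theorem integrableOn (h : IsStieltjesWeight m U) : IntegrableOn U (Set.Ioi 0) := by
  simpa using h.integrable 0

theorem of_lintegral (hU : Measurable U) (hU0 : ∀ x, 0 < x → 0 ≤ U x) (hm : ∀ n, 0 ≤ m n)
    (h : ∀ n : ℕ, ∫⁻ x in Set.Ioi (0 : ℝ), ENNReal.ofReal (x ^ n) * ENNReal.ofReal (U x) =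
      ENNReal.ofReal (m n)) : IsStieltjesWeight m U := by
  have hnn (n : ℕ) : ∀ᵐ x ∂volume.restrict (Set.Ioi (0 : ℝ)), 0 ≤ x ^ n * U x := by
    filter_upwards [ae_restrict_mem measurableSet_Ioi] with x hx
    exact mul_nonneg (pow_nonneg (le_of_lt hx) n) (hU0 x hx)
  have hl (n : ℕ) : ∫⁻ x in Set.Ioi (0 : ℝ), ENNReal.ofReal (x ^ n * U x) =
      ENNReal.ofReal (m n) := by
    rw [← h n]
    refine setLIntegral_congr_fun measurableSet_Ioi fun x hx => ?_
    exact ENNReal.ofReal_mul (pow_nonneg (le_of_lt hx) n)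
  refine ⟨?_, fun n => ⟨by fun_prop, ?_⟩, fun n => ?_⟩
  · filter_upwards [ae_restrict_mem measurableSet_Ioi] with x hx using hU0 x hx
  · rw [hasFiniteIntegral_iff_ofReal (hnn n), hl n]
    exact ENNReal.ofReal_lt_top
  · rw [integral_eq_lintegral_of_nonneg_ae (hnn n) (by fun_prop), hl n,
      ENNReal.toReal_ofReal (hm n)]

/-- Carries existence from weights to measures, and uniqueness from measures back to weights. -/
theorem isStieltjesSolution (h : IsStieltjesWeight m U) :
    IsStieltjesSolution m
      ((volume.restrict (Set.Ioi 0)).withDensity fun x => ENNReal.ofReal (U x)) := by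
  have hmeas : AEMeasurable (fun x => ENNReal.ofReal (U x)) (volume.restrict (Set.Ioi 0)) :=
    h.integrableOn.aemeasurable.ennreal_ofReal
  have htop : ∀ᵐ x ∂volume.restrict (Set.Ioi (0 : ℝ)), ENNReal.ofReal (U x) < ∞ :=
    Eventually.of_forall fun x => ENNReal.ofReal_lt_top
  have hae (n : ℕ) : (fun x => x ^ n * U x) =ᵐ[volume.restrict (Set.Ioi (0 : ℝ))]
      fun x => (ENNReal.ofReal (U x)).toReal • x ^ n := by
    filter_upwards [h.nonneg] with x hx
    rw [ENNReal.toReal_ofReal hx, smul_eq_mul, mul_comm]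
  refine ⟨withDensity_absolutelyContinuous _ _ ?_, fun n => ?_, fun n => ?_⟩
  · rw [Measure.restrict_apply measurableSet_Iio]
    convert measure_empty (μ := volume) using 2
    ext x
    simpa using fun hx => le_of_lt hx
  · rw [integrable_withDensity_iff_integrable_smul₀' hmeas htop]
    exact (h.integrable n).congr (hae n)
  · rw [integral_withDensity_eq_integral_toReal_smul₀ hmeas htop, ← h.moment n]
    exact (integral_congr_ae (hae n)).symm

theorem ae_eq (hU : IsStieltjesWeight m U) (hV : IsStieltjesWeight m V) {A C : ℝ} (hC : 0 < C)
    (hm : ∀ n, m n ≤ A * C ^ n * ((2 * n).factorial : ℝ)) :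
    ∀ᵐ x ∂volume.restrict (Set.Ioi (0 : ℝ)), V x = U x := by
  have heq := hV.isStieltjesSolution.ext hU.isStieltjesSolution hC hm
  rw [withDensity_eq_iff hV.integrableOn.aemeasurable.ennreal_ofReal
    hU.integrableOn.aemeasurable.ennreal_ofReal hV.integrableOn.lintegral_lt_top.ne] at heq
  filter_upwards [heq, hU.nonneg, hV.nonneg] with x h h1 h2
  exact (ENNReal.ofReal_eq_ofReal_iff h2 h1).1 h

end IsStieltjesWeight

/-! ### The positive weight as a mixture -/

/-- The density of `exp y * G ^ β` where `G` has the law `Gamma(c, 1)`. -/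
noncomputable def gammaPowDensity (β c y x : ℝ) : ℝ :=
  Real.exp (-(c / β) * y) / (β * Real.Gamma c) *
    (x ^ (c / β - 1) * Real.exp (-Real.exp (-y / β) * x ^ (1 / β)))

theorem gammaPowDensity_pos {β c x : ℝ} (hβ : 0 < β) (hc : 0 < c) (hx : 0 < x) (y : ℝ) :
    0 < gammaPowDensity β c y x := by
  have := Real.Gamma_pos_of_pos hc
  have := Real.rpow_pos_of_pos hx (c / β - 1)
  unfold gammaPowDensity
  positivity

theorem measurable_gammaPowDensity (β c : ℝ) :
    Measurable fun p : ℝ × ℝ => gammaPowDensity β c p.1 p.2 := by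
  unfold gammaPowDensity
  fun_prop

theorem lintegral_pow_mul_gammaPowDensity {β c : ℝ} (hβ : 0 < β) (hc : 0 < c) (y : ℝ) (n : ℕ) :
    ∫⁻ x in Set.Ioi (0 : ℝ), ENNReal.ofReal (x ^ n) * ENNReal.ofReal (gammaPowDensity β c y x) =
      ENNReal.ofReal (Real.exp (n * y)) *
        ENNReal.ofReal (Real.Gamma (β * n + c) / Real.Gamma c) := by
  set q : ℝ := n + c / β - 1 with hq
  have hq1 : -1 < q := by
    have : 0 < n + c / β := by positivity
    linarith
  have hG := Real.Gamma_pos_of_pos hc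
  have hG' := Real.Gamma_pos_of_pos (by positivity : 0 < β * n + c)
  have hint := integral_rpow_mul_exp_neg_mul_rpow (p := 1 / β) (q := q) (by positivity) hq1
    (Real.exp_pos (-y / β))
  have e1 : (q + 1) / (1 / β) = β * n + c := by rw [hq]; field_simp; ring
  have e2 : Real.exp (-y / β) ^ (-(q + 1) / (1 / β)) = Real.exp (n * y) * Real.exp (c / β * y) := by
    rw [neg_div (1 / β) (q + 1), e1, ← Real.exp_mul, ← Real.exp_add]
    congr 1
    field_simp
  rw [e1, e2, one_div_one_div] at hint
  have hint' : Integrable (fun x : ℝ => x ^ q * Real.exp (-Real.exp (-y / β) * x ^ (1 / β)))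
      (volume.restrict (Set.Ioi 0)) := by
    -- A non-integrable function has integral 0 by convention, so a nonzero value forces
    -- integrability.
    refine Integrable.of_integral_ne_zero ?_
    rw [hint]
    positivity
  have hnn : ∀ᵐ x ∂volume.restrict (Set.Ioi (0 : ℝ)),
      0 ≤ x ^ q * Real.exp (-Real.exp (-y / β) * x ^ (1 / β)) := by
    filter_upwards [ae_restrict_mem measurableSet_Ioi] with x hx
    exact mul_nonneg (Real.rpow_nonneg (le_of_lt hx) _) (Real.exp_pos _).le
  calc _ = ∫⁻ x in Set.Ioi (0 : ℝ),
        ENNReal.ofReal (Real.exp (-(c / β) * y) / (β * Real.Gamma c)) *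
          ENNReal.ofReal (x ^ q * Real.exp (-Real.exp (-y / β) * x ^ (1 / β))) := by
        refine setLIntegral_congr_fun measurableSet_Ioi fun x hx => ?_
        have hx : 0 < x := hx
        rw [← ENNReal.ofReal_mul (by positivity), ← ENNReal.ofReal_mul (by positivity),
          gammaPowDensity, hq, add_sub_assoc, Real.rpow_add hx, Real.rpow_natCast]
        congr 1
        ring
    _ = _ := by
        rw [lintegral_const_mul _ (by fun_prop), ← ofReal_integral_eq_lintegral_ofReal hint' hnn,
          hint, ← ENNReal.ofReal_mul (by positivity), ← ENNReal.ofReal_mul (by positivity)]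
        congr 1
        have : Real.exp (-(c / β) * y) * Real.exp (c / β * y) = 1 := by
          rw [← Real.exp_add]; simp
        calc _ = Real.exp (n * y) * (Real.Gamma (β * n + c) / Real.Gamma c) *
              (Real.exp (-(c / β) * y) * Real.exp (c / β * y)) := by
              generalize Real.exp (-(c / β) * y) = s, Real.exp (c / β * y) = t
              field_simp
          _ = _ := by rw [this, mul_one]

theorem exists_pos_isStieltjesWeight {α β ν : ℝ} (hα : 0 ≤ α) (hα1 : α ≤ 1) (hβ : 0 < β)
    (hν : α - 1 < ν) :
    ∃ U : ℝ → ℝ, (∀ x, 0 < x → 0 < U x) ∧ IsStieltjesWeight (genFactorial α β ν) U := by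
  obtain ⟨ρ, hρ⟩ := exists_probabilityMeasure_moment_eq_prod_gammaRatio hα hα1 hβ
  set c := 1 - α + ν with hc
  have hc0 : 0 < c := by linarith
  have hmeas := measurable_gammaPowDensity β c
  set W : ℝ → ℝ≥0∞ := fun x => ∫⁻ y, ENNReal.ofReal (gammaPowDensity β c y x) ∂(ρ : Measure ℝ)
    with hW
  have hWmeas : Measurable W := Measurable.lintegral_prod_left' hmeas.ennreal_ofReal
  have hmom (n : ℕ) : ∫⁻ x in Set.Ioi (0 : ℝ), ENNReal.ofReal (x ^ n) * W x =
      ENNReal.ofReal (genFactorial α β ν n) := by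
    calc _ = ∫⁻ x in Set.Ioi (0 : ℝ), ∫⁻ y, ENNReal.ofReal (x ^ n) *
          ENNReal.ofReal (gammaPowDensity β c y x) ∂(ρ : Measure ℝ) := by
          refine lintegral_congr fun x => ?_
          rw [lintegral_const_mul]
          exact (hmeas.comp (measurable_id.prodMk measurable_const)).ennreal_ofReal
      _ = ∫⁻ y, (∫⁻ x in Set.Ioi (0 : ℝ), ENNReal.ofReal (x ^ n) *
          ENNReal.ofReal (gammaPowDensity β c y x)) ∂(ρ : Measure ℝ) := by
          refine lintegral_lintegral_swap (Measurable.aemeasurable ?_)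
          exact (measurable_fst.pow_const n).ennreal_ofReal.mul
            (hmeas.comp measurable_swap).ennreal_ofReal
      _ = _ := by
          simp only [lintegral_pow_mul_gammaPowDensity hβ hc0]
          rw [lintegral_mul_const _ (by fun_prop), hρ, genFactorial_eq,
            ENNReal.ofReal_mul (prod_gammaRatio_pos hα1 hβ n).le]
  have hWpos (x : ℝ) (hx : 0 < x) : W x ≠ 0 := by
    intro h0
    have hm : Measurable fun y => ENNReal.ofReal (gammaPowDensity β c y x) :=
      (hmeas.comp (measurable_id.prodMk measurable_const)).ennreal_ofReal
    obtain ⟨y, hy⟩ := ((lintegral_eq_zero_iff hm).1 h0).exists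
    exact (ENNReal.ofReal_pos.2 (gammaPowDensity_pos hβ hc0 hx y)).ne' hy
  have hfin : ∀ᵐ x ∂volume.restrict (Set.Ioi (0 : ℝ)), W x < ∞ := by
    refine ae_lt_top hWmeas ?_
    have := hmom 0
    simp only [pow_zero, ENNReal.ofReal_one, one_mul] at this
    rw [this]
    exact ENNReal.ofReal_ne_top
  -- W may be infinite on a null set, where `toReal` would give 0; the value 1 keeps the weight
  -- positive everywhere on (0, ∞).
  have hpos (x : ℝ) (hx : 0 < x) : 0 < if W x = ∞ then 1 else (W x).toReal := by
    split_ifs with h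
    · exact one_pos
    · exact ENNReal.toReal_pos (hWpos x hx) h
  refine ⟨fun x => if W x = ∞ then 1 else (W x).toReal, hpos, IsStieltjesWeight.of_lintegral
    (Measurable.ite (hWmeas (measurableSet_singleton ∞)) measurable_const hWmeas.ennreal_toReal)
    (fun x hx => (hpos x hx).le) (fun n => (genFactorial_pos hα1 hβ hν n).le) fun n => ?_⟩
  rw [← hmom n]
  refine lintegral_congr_ae ?_
  filter_upwards [hfin] with x hx
  rw [if_neg hx.ne, ENNReal.ofReal_toReal hx.ne]

theorem mainTheorem1 (α β ν : ℝ) (hα : 0 ≤ α) (hα1 : α ≤ 1) (hβ : 0 < β) (hν : α - 1 < ν)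
    (hαβ : (α + β) / 2 ≤ 1) :
    Tendsto (fun N : ℕ => ∑ n ∈ Finset.Icc 1 N,
        genFactorial α β ν n ^ (-(1 / (2 * (n : ℝ))))) atTop atTop ∧
    (∃! μ : Measure ℝ, IsStieltjesSolution (genFactorial α β ν) μ) ∧
    (∃ U : ℝ → ℝ, (∀ x : ℝ, 0 < x → 0 < U x) ∧
      IsStieltjesWeight (genFactorial α β ν) U ∧
      ∀ V : ℝ → ℝ, IsStieltjesWeight (genFactorial α β ν) V →
        ∀ᵐ x ∂(volume.restrict (Set.Ioi (0 : ℝ))), V x = U x) := by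
  obtain ⟨A, C, hC, hm⟩ := exists_genFactorial_le hα hα1 hβ hν (by linarith)
  obtain ⟨U, hU, hUw⟩ := exists_pos_isStieltjesWeight hα hα1 hβ hν
  refine ⟨tendsto_sum_rpow_atTop_of_le_factorial (genFactorial_pos hα1 hβ hν) hC.le hm,
    ⟨_, hUw.isStieltjesSolution, fun μ hμ => hμ.ext hUw.isStieltjesSolution hC hm⟩,
    U, hU, hUw, fun V hV => hUw.ae_eq hV hC hm⟩
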